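/- **Syntax.** Formulas of converse PDL are in negation normal form, $\varphi ::= \top\mid\bot\mid p\mid\bar p\mid\varphi\wedge\varphi\mid\varphi\vee\varphi\mid\langle\alpha\rangle\varphi\mid[\alpha]\varphi$, $\alpha ::= a\mid\breve a\mid\alpha;\alpha\mid\alpha\cup\alpha\mid\alpha^*\mid\varphi?$, with the usual Kripke semantics. $\mathsf{Voc}(\cdot)$ is the set of propositions and atomic programs that occur, where $a$ counts as occurring if $a$ or $\breve a$ occurs. $\overline\varphi$ is the negation of $\varphi$ in normal form, and $\mathsf{FL}^{\neg}(\Gamma)$ is the Fischer–Ladner closure of $\Gamma$ together with the negations of its members. A sequent is a finite set of formulas annotated $f$ (in focus) or $u$ (not in focus), read conjunctively; a split sequent $\Gamma\,\|\,\Xi$ has at most one formula in focus. **Proofs.** A split proof is a finite tree of split sequents. Each leaf is an initial sequent (it contains $\bot$, or some $\varphi$ and $\overline\varphi$) or a repeat: it has a proper ancestor (its companion) with the same label such that every sequent on the path between them has a formula in focus and this formula is principal at least once. Each inner node is obtained by a rule acting on the left or right component: the usual (refutation) rules for $\wedge,\vee$, for $\langle\alpha\rangle,[\alpha]$ with $\alpha$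 a composition, choice, iteration or test, the modal rule, cut on a formula from $\mathsf{FL}^{\neg}$ of the component, weakening, focusing and unfocusing. The rules for $\langle\alpha\rangle\varphi$ keep the focus on the residual of $\langle\alpha\rangle\varphi$. The modal rule for $\langle a\rangle\varphi^o$ ($a$ atomic or a converse) replaces both components $\Delta$ by $\{\chi^u : [a]\chi\in\Delta\}\cup\{\langle\breve a\rangle\chi^u : \chi\in\Delta,\ \langle\breve a\rangle\chi\in\mathsf{FL}^{\neg}(\Delta)\}$ and adds $\varphi^o$ to the component of the principal formula. **Setting.** Let $C$ be a proper cluster of a split proof (a strongly connected component, containing a cycle, of the graph of child edges and repeat-to-companion edges), let $r$ be its root, labelled $\Gamma\,\|\,\Xi$ with $\Gamma\neq\emptyset$. Assume that all sequents in $C$ have a formula in focus in the right component, and that at any two nodes of $C$ at which right rules are applied and which have the same right component the same right rule is applied to the same principal formula (uniformity). Let $C^+$ be $C$ together with the children of its nodes, and let $\theta_t$ be an interpolant of the split sequent $\Lambda^l_t\,\|\,\Lambda^r_t$ at $t$, for each $t\in C^+\setminus C$: that is, $\mathsf{Voc}(\theta_t)\subseteq\mathsf{Voc}(\Lambda_t^l)\cap\mathsf{Voc}(\Lambda_t^r)$,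 and $\Lambda_t^l\,\|\,\theta_t$ and $\overline{\theta_t}\,\|\,\Lambda_t^r$ are unsatisfiable. For a sequent $\Delta$ let $\theta_\Delta=\bigwedge\{\theta_t : t\in C^+\setminus C,\ \Lambda_t^r=\Delta\}$. **Quasi-proof.** $Q$ is the finite tree whose nodes $x$ have a kind $k(x)\in\{1,2,3\}$ and a label $\Psi_x$, built as follows. The root has kind 1 and label $\Xi$. A node $x$ of kind 1 is a leaf if some proper ancestor of kind 1 has the same label (then $x$ is a repeat, and that ancestor is its companion $c(x)$), or if no $t\in C$ has $\Lambda_t^r=\Psi_x$ (then $x$ is an exit); otherwise it has one child, of kind 2, with the same label. A node of kind 2 has one child, of kind 3, with the same label. A node $x$ of kind 3 has one child of kind 1 for each premise of the right rule applied at the nodes $t\in C$ with $\Lambda^r_t=\Psi_x$, labelled by the right component of that premise; $\Psi_x$ is called modal if this rule is the modal rule. $K(x)$ is the set of proper ancestors $y$ of $x$ such that $y=c(z)$ for some repeat $z$ that is $x$ or a descendant of $x$. **Pre-interpolants.** Take distinct fresh propositions $q_y$, $y\in Q$. Formulas $\psi_x$ and programs $\alpha_{x,y}$ ($y\in K(x)$)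 are defined from the leaves to the root (below, $z$ is the unique child of $x$ if there is just one): * repeat: $\psi_x=\bot$, $\alpha_{x,c(x)}=\top?$; exit: $\psi_x=\theta_{\Psi_x}$; * $k(x)=1$, companion: $\psi_x=\langle\alpha_{z,x}^*\rangle\psi_z$, $\alpha_{x,y}=\alpha_{z,x}^*;\alpha_{z,y}$; $k(x)=1$, neither a leaf nor a companion: $\psi_x=\psi_z$, $\alpha_{x,y}=\alpha_{z,y}$; * $k(x)=2$: $\psi_x=\langle\theta_{\Psi_x}?\rangle\psi_z$, $\alpha_{x,y}=\theta_{\Psi_x}?;\alpha_{z,y}$; * $k(x)=3$, not modal: $\psi_x=\bigvee_z\psi_z$, $\alpha_{x,y}=\bigcup\{\alpha_{z,y} : y\in K(z)\}$, with $z$ ranging over the children of $x$; * $k(x)=3$, modal, with action $a$: $\psi_x=\langle a\rangle\psi_z$, $\alpha_{x,y}=a;\alpha_{z,y}$. Let $\iota_x=\psi_x\vee\bigvee_{y\in K(x)}\langle\alpha_{x,y}\rangle q_y$, and let $\theta_r=\iota_{x_0}$ for the root $x_0$ of $Q$. **Lemma.** For every node $x$ of $Q$, $\mathsf{Voc}(\iota_x)\subseteq\big(\mathsf{Voc}(\Gamma)\cap\mathsf{Voc}(\Xi)\big)\cup\{q_y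 : y\in K(x)\}$. Consequently, $\mathsf{Voc}(\theta_r)\subseteq\mathsf{Voc}(\Gamma)\cap\mathsf{Voc}(\Xi)$. -/

import Mathlib

universe u v

namespace CPDL

/-- Actions: an atomic program `a`, or its converse (second component `true`). -/
abbrev Action (A : Type v) := A × Bool

/-- The converse of an action; it is an involution. -/
def Action.conv {A : Type v} (a : Action A) : Action A := (a.1, !a.2)

mutual
/-- Formulas of converse PDL in negation normal form. -/
inductive Fml (P : Type u) (A : Type v) : Type (max u v)
  | top : Fml P A
  | bot : Fml P A
  | pos : P → Fml P A
  | npos : P → Fml P A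
  | and : Fml P A → Fml P A → Fml P A
  | or : Fml P A → Fml P A → Fml P A
  | dia : Prog P A → Fml P A → Fml P A
  | box : Prog P A → Fml P A → Fml P A
/-- Programs of converse PDL. -/
inductive Prog (P : Type u) (A : Type v) : Type (max u v)
  | act : Action A → Prog P A
  | seq : Prog P A → Prog P A → Prog P A
  | alt : Prog P A → Prog P A → Prog P A
  | star : Prog P A → Prog P A
  | test : Fml P A → Prog P A
end

/-- The negation of a formula, as a formula in negation normal form. -/
def Fml.neg {P : Type u} {A : Type v} : Fml P A → Fml P A
  | .top => .bot
  | .bot => .top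
  | .pos p => .npos p
  | .npos p => .pos p
  | .and φ ψ => .or φ.neg ψ.neg
  | .or φ ψ => .and φ.neg ψ.neg
  | .dia α φ => .box α φ.neg
  | .box α φ => .dia α φ.neg

mutual
/-- Vocabulary of a formula: its propositions and its atomic programs, where `a` belongs to the
vocabulary as soon as `a` or its converse occurs. -/
def Fml.voc {P : Type u} {A : Type v} : Fml P A → Set (P ⊕ A)
  | .top => ∅
  | .bot => ∅
  | .pos p => {Sum.inl p}
  | .npos p => {Sum.inl p}
  | .and φ ψ => φ.voc ∪ ψ.voc
  | .or φ ψ => φ.voc ∪ ψ.voc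
  | .dia α φ => α.voc ∪ φ.voc
  | .box α φ => α.voc ∪ φ.voc
/-- Vocabulary of a program. -/
def Prog.voc {P : Type u} {A : Type v} : Prog P A → Set (P ⊕ A)
  | .act a => {Sum.inr a.1}
  | .seq α β => α.voc ∪ β.voc
  | .alt α β => α.voc ∪ β.voc
  | .star α => α.voc
  | .test φ => φ.voc
end

/-- Finite disjunctions; the empty one is `⊥`. -/
def bigOr {P : Type u} {A : Type v} : List (Fml P A) → Fml P A
  | [] => .bot
  | [φ] => φ
  | φ :: ψ :: l => .or φ (bigOr (ψ :: l))

/-- Finite conjunctions; the empty one is `⊤`. -/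
def bigAnd {P : Type u} {A : Type v} : List (Fml P A) → Fml P A
  | [] => .top
  | [φ] => φ
  | φ :: ψ :: l => .and φ (bigAnd (ψ :: l))

/-- Finite choices of programs; the empty one is `⊥?`. -/
def bigAlt {P : Type u} {A : Type v} : List (Prog P A) → Prog P A
  | [] => .test .bot
  | [α] => α
  | α :: β :: l => .alt α (bigAlt (β :: l))

/-! ### Semantics -/

/-- Kripke models. -/
structure Model (P : Type u) (A : Type v) (W : Type) where
  val : P → W → Prop
  acc : A → W → W → Prop

mutual
/-- Truth of a formula at a state. -/
def Model.sat {P : Type u} {A : Type v} {W : Type} (M : Model P A W) : Fml P A → W → Prop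
  | .top, _ => True
  | .bot, _ => False
  | .pos p, w => M.val p w
  | .npos p, w => ¬ M.val p w
  | .and φ ψ, w => M.sat φ w ∧ M.sat ψ w
  | .or φ ψ, w => M.sat φ w ∨ M.sat ψ w
  | .dia α φ, w => ∃ x, M.rel α w x ∧ M.sat φ x
  | .box α φ, w => ∀ x, M.rel α w x → M.sat φ x
/-- The accessibility relation of a program. -/
def Model.rel {P : Type u} {A : Type v} {W : Type} (M : Model P A W) : Prog P A → W → W → Prop
  | .act (a, false), w, x => M.acc a w x
  | .act (a, true), w, x => M.acc a x w
  | .seq α β, w, x => ∃ v, M.rel α w v ∧ M.rel β v x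
  | .alt α β, w, x => M.rel α w x ∨ M.rel β w x
  | .star α, w, x => Relation.ReflTransGen (M.rel α) w x
  | .test φ, w, x => w = x ∧ M.sat φ w
end

/-- No state of any model satisfies all the formulas of `S`. -/
def Unsat {P : Type u} {A : Type v} (S : Set (Fml P A)) : Prop :=
  ∀ (W : Type) (M : Model P A W) (w : W), ¬ ∀ φ ∈ S, M.sat φ w

/-! ### Fischer-Ladner closure -/

/-- The Fischer-Ladner closure of a set of formulas. -/
inductive FL {P : Type u} {A : Type v} (S : Set (Fml P A)) : Fml P A → Prop
  | base {φ} : φ ∈ S → FL S φ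
  | and_left {φ ψ} : FL S (.and φ ψ) → FL S φ
  | and_right {φ ψ} : FL S (.and φ ψ) → FL S ψ
  | or_left {φ ψ} : FL S (.or φ ψ) → FL S φ
  | or_right {φ ψ} : FL S (.or φ ψ) → FL S ψ
  | dia_act {a φ} : FL S (.dia (.act a) φ) → FL S φ
  | dia_seq {α β φ} : FL S (.dia (.seq α β) φ) → FL S (.dia α (.dia β φ))
  | dia_alt_left {α β φ} : FL S (.dia (.alt α β) φ) → FL S (.dia α φ)
  | dia_alt_right {α β φ} : FL S (.dia (.alt α β) φ) → FL S (.dia β φ)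
  | dia_star_stop {α φ} : FL S (.dia (.star α) φ) → FL S φ
  | dia_star_loop {α φ} : FL S (.dia (.star α) φ) → FL S (.dia α (.dia (.star α) φ))
  | dia_test_left {ψ φ} : FL S (.dia (.test ψ) φ) → FL S ψ
  | dia_test_right {ψ φ} : FL S (.dia (.test ψ) φ) → FL S φ
  | box_act {a φ} : FL S (.box (.act a) φ) → FL S φ
  | box_seq {α β φ} : FL S (.box (.seq α β) φ) → FL S (.box α (.box β φ))
  | box_alt_left {α β φ} : FL S (.box (.alt α β) φ) → FL S (.box α φ)
  | box_alt_right {α β φ} : FL S (.box (.alt α β) φ) → FL S (.box β φ)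
  | box_star_stop {α φ} : FL S (.box (.star α) φ) → FL S φ
  | box_star_loop {α φ} : FL S (.box (.star α) φ) → FL S (.box α (.box (.star α) φ))
  | box_test_left {ψ φ} : FL S (.box (.test ψ) φ) → FL S ψ.neg
  | box_test_right {ψ φ} : FL S (.box (.test ψ) φ) → FL S φ

/-- The closure of the Fischer-Ladner closure under negation. -/
def FLneg {P : Type u} {A : Type v} (S : Set (Fml P A)) : Set (Fml P A) :=
  {φ | FL S φ ∨ ∃ ψ, FL S ψ ∧ φ = ψ.neg}

/-! ### Sequents and rules -/

/-- Annotations: in focus, or out of focus. -/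
inductive Ann
  | f
  | u

/-- Sets of annotated formulas, read conjunctively. -/
abbrev Sequent (P : Type u) (A : Type v) := Set (Fml P A × Ann)

/-- The formulas of a sequent, without their annotations. -/
def Sequent.forms {P : Type u} {A : Type v} (Γ : Sequent P A) : Set (Fml P A) :=
  {φ | ∃ o, (φ, o) ∈ Γ}

/-- The vocabulary of a sequent. -/
def Sequent.voc {P : Type u} {A : Type v} (Γ : Sequent P A) : Set (P ⊕ A) :=
  ⋃ φ ∈ Γ.forms, φ.voc

/-- Some formula of the sequent is in focus. -/
def Sequent.Focused {P : Type u} {A : Type v} (Γ : Sequent P A) : Prop :=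
  ∃ φ, (φ, Ann.f) ∈ Γ

/-- The part of a sequent that is transferred along an `a`-step: the arguments of its
`[a]`-formulas, and those formulas `⟨ă⟩χ` with `χ` in the sequent that lie in the
(negation-closed) Fischer-Ladner closure of the sequent. -/
def Sequent.jump {P : Type u} {A : Type v} (a : Action A) (Γ : Sequent P A) : Sequent P A :=
  {x | ∃ χ o, x = (χ, Ann.u) ∧ (Fml.box (.act a) χ, o) ∈ Γ} ∪
  {x | ∃ χ o, x = (Fml.dia (.act a.conv) χ, Ann.u) ∧ (χ, o) ∈ Γ ∧
    Fml.dia (.act a.conv) χ ∈ FLneg Γ.forms}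

/-- Instances of the proof rules, as they act on the component that contains the principal
formula. The last argument is the context. -/
inductive Rule (P : Type u) (A : Type v) : Type (max u v)
  | and (φ ψ : Fml P A) (Γ : Sequent P A)
  | or (φ ψ : Fml P A) (Γ : Sequent P A)
  | diaAct (a : Action A) (φ : Fml P A) (o : Ann) (Γ : Sequent P A)
  | diaSeq (α β : Prog P A) (φ : Fml P A) (o : Ann) (Γ : Sequent P A)
  | diaAlt (α β : Prog P A) (φ : Fml P A) (o : Ann) (Γ : Sequent P A)
  | diaStar (α : Prog P A) (φ : Fml P A) (o : Ann) (Γ : Sequent P A)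
  | diaTest (ψ φ : Fml P A) (o : Ann) (Γ : Sequent P A)
  | boxSeq (α β : Prog P A) (φ : Fml P A) (Γ : Sequent P A)
  | boxAlt (α β : Prog P A) (φ : Fml P A) (Γ : Sequent P A)
  | boxStar (α : Prog P A) (φ : Fml P A) (Γ : Sequent P A)
  | boxTest (ψ φ : Fml P A) (Γ : Sequent P A)
  | cut (φ : Fml P A) (Γ : Sequent P A)
  | weak (φ : Fml P A) (o : Ann) (Γ : Sequent P A)
  | focus (φ : Fml P A) (Γ : Sequent P A)
  | unfocus (φ : Fml P A) (Γ : Sequent P A)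

namespace Rule

/-- The conclusion of a rule instance (active component). -/
def concl {P : Type u} {A : Type v} : Rule P A → Sequent P A
  | .and φ ψ Γ => insert (.and φ ψ, .u) Γ
  | .or φ ψ Γ => insert (.or φ ψ, .u) Γ
  | .diaAct a φ o Γ => insert (.dia (.act a) φ, o) Γ
  | .diaSeq α β φ o Γ => insert (.dia (.seq α β) φ, o) Γ
  | .diaAlt α β φ o Γ => insert (.dia (.alt α β) φ, o) Γ
  | .diaStar α φ o Γ => insert (.dia (.star α) φ, o) Γ
  | .diaTest ψ φ o Γ => insert (.dia (.test ψ) φ, o) Γ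
  | .boxSeq α β φ Γ => insert (.box (.seq α β) φ, .u) Γ
  | .boxAlt α β φ Γ => insert (.box (.alt α β) φ, .u) Γ
  | .boxStar α φ Γ => insert (.box (.star α) φ, .u) Γ
  | .boxTest ψ φ Γ => insert (.box (.test ψ) φ, .u) Γ
  | .cut _ Γ => Γ
  | .weak φ o Γ => insert (φ, o) Γ
  | .focus φ Γ => insert (φ, .u) Γ
  | .unfocus φ Γ => insert (φ, .f) Γ

/-- The premises of a rule instance (active component). -/
def prems {P : Type u} {A : Type v} : Rule P A → List (Sequent P A)
  | .and φ ψ Γ => [insert (φ, .u) (insert (ψ, .u) Γ)]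
  | .or φ ψ Γ => [insert (φ, .u) Γ, insert (ψ, .u) Γ]
  | .diaAct a φ o Γ =>
      [insert (φ, o) (Sequent.jump a (insert (.dia (.act a) φ, o) Γ))]
  | .diaSeq α β φ o Γ => [insert (.dia α (.dia β φ), o) Γ]
  | .diaAlt α β φ o Γ => [insert (.dia α φ, o) Γ, insert (.dia β φ, o) Γ]
  | .diaStar α φ o Γ => [insert (φ, o) Γ, insert (.dia α (.dia (.star α) φ), o) Γ]
  | .diaTest ψ φ o Γ => [insert (ψ, .u) (insert (φ, o) Γ)]
  | .boxSeq α β φ Γ => [insert (.box α (.box β φ), .u) Γ]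
  | .boxAlt α β φ Γ => [insert (.box α φ, .u) (insert (.box β φ, .u) Γ)]
  | .boxStar α φ Γ => [insert (φ, .u) (insert (.box α (.box (.star α) φ), .u) Γ)]
  | .boxTest ψ φ Γ => [insert (ψ.neg, .u) Γ, insert (φ, .u) Γ]
  | .cut φ Γ => [insert (φ, .u) Γ, insert (φ.neg, .u) Γ]
  | .weak _ _ Γ => [Γ]
  | .focus φ Γ => [insert (φ, .f) Γ]
  | .unfocus φ Γ => [insert (φ, .u) Γ]

/-- Side condition: cuts are analytic. -/
def Side {P : Type u} {A : Type v} : Rule P A → Prop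
  | .cut φ Γ => φ ∈ FLneg Γ.forms
  | _ => True

/-- The action of an instance of the modal rule. -/
def modal {P : Type u} {A : Type v} : Rule P A → Option (Action A)
  | .diaAct a _ _ _ => some a
  | _ => none

/-- What the rule does to the component that does not contain the principal formula. -/
def passive {P : Type u} {A : Type v} (R : Rule P A) (Γ : Sequent P A) : Sequent P A :=
  match R.modal with
  | some a => Γ.jump a
  | none => Γ

/-- The rule instance decomposes a formula in focus. -/
def PrincipalInFocus {P : Type u} {A : Type v} : Rule P A → Prop
  | .diaAct _ _ o _ => o = .f
  | .diaSeq _ _ _ o _ => o = .f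
  | .diaAlt _ _ _ o _ => o = .f
  | .diaStar _ _ o _ => o = .f
  | .diaTest _ _ o _ => o = .f
  | _ => False

end Rule

/-- Split sequents `l ‖ r`. -/
@[ext] structure Split (P : Type u) (A : Type v) where
  l : Sequent P A
  r : Sequent P A

namespace Split

/-- Both components are finite, and at most one formula occurrence is in focus. -/
def WF {P : Type u} {A : Type v} (S : Split P A) : Prop :=
  S.l.Finite ∧ S.r.Finite ∧
  {φ | (φ, Ann.f) ∈ S.l}.Subsingleton ∧ {φ | (φ, Ann.f) ∈ S.r}.Subsingleton ∧
  ¬ (S.l.Focused ∧ S.r.Focused)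

/-- Some formula of the split sequent is in focus. -/
def Focused {P : Type u} {A : Type v} (S : Split P A) : Prop := S.l.Focused ∨ S.r.Focused

/-- Initial sequents. -/
def Closed {P : Type u} {A : Type v} (S : Split P A) : Prop :=
  Fml.bot ∈ (S.l ∪ S.r : Sequent P A).forms ∨
  ∃ φ : Fml P A, φ ∈ (S.l ∪ S.r : Sequent P A).forms ∧ φ.neg ∈ (S.l ∪ S.r : Sequent P A).forms

end Split

/-- `θ` is an interpolant of the split sequent `S = Γ ‖ Ξ`. -/
def IsInterpolant {P : Type u} {A : Type v} (θ : Fml P A) (S : Split P A) : Prop :=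
  θ.voc ⊆ S.l.voc ∩ S.r.voc ∧ Unsat (S.l.forms ∪ {θ}) ∧ Unsat ({θ.neg} ∪ S.r.forms)

/-! ### Cyclic split proofs -/

/-- What happens at a node of a proof: it is an initial sequent, the conclusion of a rule with
principal formula on the left or on the right, or a repeat leaf with the given companion. -/
inductive Step (P : Type u) (A : Type v) : Type (max u v)
  | closed
  | left (R : Rule P A)
  | right (R : Rule P A)
  | rep (c : List ℕ)

/-- Cyclic split proofs. Nodes are addresses in a finite tree: the root is `[]`, and the `i`-th child
of `t` is `i :: t`, so that `s <:+ t` says that `s` is `t` or an ancestor of `t`. -/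
structure SplitProof (P : Type u) (A : Type v) where
  nodes : Finset (List ℕ)
  label : List ℕ → Split P A
  step : List ℕ → Step P A
  root_mem : [] ∈ nodes
  parent_mem : ∀ i t, i :: t ∈ nodes → t ∈ nodes
  wf : ∀ t ∈ nodes, (label t).WF
  closed_ok : ∀ t ∈ nodes, step t = .closed → (label t).Closed ∧ ∀ i, i :: t ∉ nodes
  left_ok : ∀ t ∈ nodes, ∀ R, step t = .left R → R.Side ∧ (label t).l = R.concl ∧
    (∀ i, i :: t ∈ nodes ↔ i < R.prems.length) ∧
    ∀ i (h : i < R.prems.length), label (i :: t) = ⟨R.prems[i], R.passive (label t).r⟩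
  right_ok : ∀ t ∈ nodes, ∀ R, step t = .right R → R.Side ∧ (label t).r = R.concl ∧
    (∀ i, i :: t ∈ nodes ↔ i < R.prems.length) ∧
    ∀ i (h : i < R.prems.length), label (i :: t) = ⟨R.passive (label t).l, R.prems[i]⟩
  /-- A repeat carries the label of its companion, a proper ancestor, every sequent on the path
  between them has a formula in focus, and that formula is principal somewhere on the path. -/
  rep_ok : ∀ t ∈ nodes, ∀ c, step t = .rep c → (∀ i, i :: t ∉ nodes) ∧
    c <:+ t ∧ c ≠ t ∧ label c = label t ∧
    (∀ s, c <:+ s → s <:+ t → (label s).Focused) ∧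
    ∃ s, c <:+ s ∧ s <:+ t ∧ ∃ R, (step s = .left R ∨ step s = .right R) ∧ R.PrincipalInFocus

namespace SplitProof

/-- The edges of the graph of a proof: from parents to children and from repeats to companions. -/
def Edge {P : Type u} {A : Type v} (π : SplitProof P A) (s t : List ℕ) : Prop :=
  s ∈ π.nodes ∧ t ∈ π.nodes ∧ ((∃ i, t = i :: s) ∨ π.step s = .rep t)

/-- `C` is a proper cluster: a strongly connected component of the graph of the proof that contains
a cycle. -/
def IsProperCluster {P : Type u} {A : Type v} (π : SplitProof P A) (C : Finset (List ℕ)) : Prop :=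
  C.Nonempty ∧ ∀ s ∈ C, ∀ t, t ∈ C ↔
    Relation.TransGen π.Edge s t ∧ Relation.TransGen π.Edge t s

/-- `r` is the root of the cluster `C`: its element closest to the root of the proof. -/
def IsClusterRoot {P : Type u} {A : Type v} (_π : SplitProof P A) (C : Finset (List ℕ))
    (r : List ℕ) : Prop :=
  r ∈ C ∧ ∀ t ∈ C, r <:+ t

/-- Every sequent of the cluster has a formula in focus in its right component. -/
def RightFocused {P : Type u} {A : Type v} (π : SplitProof P A) (C : Finset (List ℕ)) : Prop :=
  ∀ t ∈ C, (π.label t).r.Focused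

/-- Whenever right rules are applied at two nodes of the cluster with the same right component, it
is the same rule instance. -/
def Uniform {P : Type u} {A : Type v} (π : SplitProof P A) (C : Finset (List ℕ)) : Prop :=
  ∀ s ∈ C, ∀ t ∈ C, ∀ R R₂, π.step s = .right R → π.step t = .right R₂ →
    (π.label s).r = (π.label t).r → R = R₂

open Classical in
/-- `C⁺`: the cluster together with the children of its nodes. -/
noncomputable def cplus {P : Type u} {A : Type v} (π : SplitProof P A) (C : Finset (List ℕ)) :
    Finset (List ℕ) :=
  π.nodes.filter fun t => t ∈ C ∨ ∃ s ∈ C, ∃ i, t = i :: s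

open Classical in
/-- `θ_Δ`: the conjunction of the given interpolants of the exits with right component `Δ`. -/
noncomputable def thetaAt {P : Type u} {A : Type v} (π : SplitProof P A) (C : Finset (List ℕ))
    (θ : List ℕ → Fml P A) (Δ : Sequent P A) : Fml P A :=
  bigAnd (((π.cplus C).filter fun t => t ∉ C ∧ (π.label t).r = Δ).toList.map θ)

open Classical in
/-- The right rule that is applied at the nodes of the cluster with right component `Δ` (unique
if the proof is uniform). -/
noncomputable def rightRule {P : Type u} {A : Type v} (π : SplitProof P A) (C : Finset (List ℕ))
    (Δ : Sequent P A) : Option (Rule P A) :=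
  if h : ∃ R, ∃ t ∈ C, (π.label t).r = Δ ∧ π.step t = .right R then some h.choose else none

/-- The right components of the sequents of the cluster. -/
def rights {P : Type u} {A : Type v} (π : SplitProof P A) (C : Finset (List ℕ)) :
    Set (Sequent P A) :=
  Set.image (fun t => (π.label t).r) (C : Set (List ℕ))

end SplitProof

/-! ### Quasi-proofs -/

/-- Finite trees labelled by sequents, with nodes of kinds 1 (leaf or with one child), 2 and 3. A
node of kind 3 also records the right rule applied at the nodes of the cluster it stands for. -/
inductive QTree (P : Type u) (A : Type v) : Type (max u v)
  | leaf (Δ : Sequent P A)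
  | one (Δ : Sequent P A) (z : QTree P A)
  | two (Δ : Sequent P A) (z : QTree P A)
  | three (Δ : Sequent P A) (R : Option (Rule P A)) (n : ℕ) (z : Fin n → QTree P A)

namespace QTree

/-- The kind of the root node. -/
def kind {P : Type u} {A : Type v} : QTree P A → ℕ
  | leaf _ => 1
  | one _ _ => 1
  | two _ _ => 2
  | three _ _ _ _ => 3

/-- The label of the root node. -/
def lab {P : Type u} {A : Type v} : QTree P A → Sequent P A
  | leaf Δ => Δ
  | one Δ _ => Δ
  | two Δ _ => Δ
  | three Δ _ _ _ => Δ

/-- The `i`-th immediate subtree. -/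
def child {P : Type u} {A : Type v} : QTree P A → ℕ → Option (QTree P A)
  | leaf _, _ => none
  | one _ z, i => if i = 0 then some z else none
  | two _ z, i => if i = 0 then some z else none
  | three _ _ n z, i => if h : i < n then some (z ⟨i, h⟩) else none

/-- The subtree at an address (the `i`-th child of `x` is `i :: x`). -/
def sub {P : Type u} {A : Type v} (Q : QTree P A) : List ℕ → Option (QTree P A)
  | [] => some Q
  | i :: x => (Q.sub x).bind fun T => T.child i

/-- The nodes of the tree. -/
def nodes {P : Type u} {A : Type v} (Q : QTree P A) : Set (List ℕ) :=
  {x | ∃ T, Q.sub x = some T}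

/-- `z` is a repeat with companion `y`: both have kind 1, `y` is a proper ancestor of `z`, and they
have the same label. -/
def IsRepeatOf {P : Type u} {A : Type v} (Q : QTree P A) (z y : List ℕ) : Prop :=
  y <:+ z ∧ y ≠ z ∧ ∃ T S, Q.sub z = some T ∧ Q.sub y = some S ∧
    T.kind = 1 ∧ S.kind = 1 ∧ T.lab = S.lab

/-- `x` is a repeat. -/
def IsRepeat {P : Type u} {A : Type v} (Q : QTree P A) (x : List ℕ) : Prop :=
  ∃ y, Q.IsRepeatOf x y

/-- `x` is a companion. -/
def IsCompanion {P : Type u} {A : Type v} (Q : QTree P A) (x : List ℕ) : Prop :=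
  ∃ z, Q.IsRepeatOf z x

open Classical in
/-- `K(x)`: the companions `y`, properly above `x`, of the repeats that are `x` or below `x`. -/
noncomputable def K {P : Type u} {A : Type v} (Q : QTree P A) (x : List ℕ) : List (List ℕ) :=
  x.tails.tail.filter fun y => ∃ z, x <:+ z ∧ Q.IsRepeatOf z y

open Classical in
/-- The program `α_{x,y}`, where `T` is the subtree of `Q` at `x`. It is used for `y ∈ K(x)` only. -/
noncomputable def alpha {P : Type u} {A : Type v} (Q : QTree P A) (th : Sequent P A → Fml P A) :
    QTree P A → List ℕ → List ℕ → Prog P A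
  | leaf _, _, _ => .test .top
  | one _ z, x, y =>
      if Q.IsCompanion x then .seq (.star (alpha Q th z (0 :: x) x)) (alpha Q th z (0 :: x) y)
      else alpha Q th z (0 :: x) y
  | two Δ z, x, y => .seq (.test (th Δ)) (alpha Q th z (0 :: x) y)
  | three _ R n z, x, y =>
      let β := bigAlt (((List.finRange n).filter fun i => y ∈ Q.K (i.val :: x)).map
        fun i => alpha Q th (z i) (i.val :: x) y)
      match R.bind Rule.modal with
      | some a => .seq (.act a) β
      | none => β

open Classical in
/-- The formula `ψ_x`, where `T` is the subtree of `Q` at `x`. -/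
noncomputable def psi {P : Type u} {A : Type v} (Q : QTree P A) (th : Sequent P A → Fml P A) :
    QTree P A → List ℕ → Fml P A
  | leaf Δ, x => if Q.IsRepeat x then .bot else th Δ
  | one _ z, x =>
      if Q.IsCompanion x then .dia (.star (alpha Q th z (0 :: x) x)) (psi Q th z (0 :: x))
      else psi Q th z (0 :: x)
  | two Δ z, x => .dia (.test (th Δ)) (psi Q th z (0 :: x))
  | three _ R n z, x =>
      let χ := bigOr ((List.finRange n).map fun i => psi Q th (z i) (i.val :: x))
      match R.bind Rule.modal with
      | some a => .dia (.act a) χ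
      | none => χ

/-- The pre-interpolant `ι_x = ψ_x ∨ ⋁_{y ∈ K(x)} ⟨α_{x,y}⟩ q_y`. -/
noncomputable def iota {P : Type u} {A : Type v} (Q : QTree P A) (th : Sequent P A → Fml P A)
    (q : List ℕ → P) (x : List ℕ) : Fml P A :=
  match Q.sub x with
  | some T => .or (Q.psi th T x)
      (bigOr ((Q.K x).map fun y => .dia (Q.alpha th T x y) (.pos (q y))))
  | none => .bot

end QTree

namespace SplitProof

theorem ncard_rights_lt {P : Type u} {A : Type v} (π : SplitProof P A) (C : Finset (List ℕ))
    {anc : Set (Sequent P A)} {Δ : Sequent P A} (h : Δ ∈ π.rights C ∧ Δ ∉ anc) :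
    (π.rights C \ insert Δ anc).ncard < (π.rights C \ anc).ncard := by
  refine Set.ncard_lt_ncard ⟨fun x hx => ⟨hx.1, fun hm => hx.2 (Or.inr hm)⟩, fun hs => ?_⟩
    ((C.finite_toSet.image _).subset Set.sdiff_subset)
  exact (hs ⟨h.1, h.2⟩).2 (Or.inl rfl)

open Classical in
/-- The part of the quasi-proof below a node of kind 1 with label `Δ`, where `anc` is the set of
labels of the proper ancestors of kind 1 of that node. If `Δ ∈ anc`, the node is a repeat; if no
sequent of the cluster has right component `Δ`, it is an exit. Otherwise it is followed by nodes of
kinds 2 and 3 with label `Δ`, and then by one node of kind 1 for every premise of the right rule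
applied at `Δ`. -/
noncomputable def build {P : Type u} {A : Type v} (π : SplitProof P A) (C : Finset (List ℕ))
    (anc : Set (Sequent P A)) (Δ : Sequent P A) : QTree P A :=
  if _h : Δ ∈ π.rights C ∧ Δ ∉ anc then
    .one Δ (.two Δ (.three Δ (π.rightRule C Δ)
      ((π.rightRule C Δ).elim [] Rule.prems).length
      fun i => π.build C (insert Δ anc) (((π.rightRule C Δ).elim [] Rule.prems).get i)))
  else .leaf Δ
termination_by (π.rights C \ anc).ncard
decreasing_by exact π.ncard_rights_lt C _h

/-- The quasi-proof of the cluster `C` with root `r`. -/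
noncomputable def quasiProof {P : Type u} {A : Type v} (π : SplitProof P A) (C : Finset (List ℕ))
    (r : List ℕ) : QTree P A :=
  π.build C ∅ (π.label r).r

/-- The pre-interpolant `ι_x` at the node `x` of the quasi-proof. -/
noncomputable def preInterpolant {P : Type u} {A : Type v} (π : SplitProof P A)
    (C : Finset (List ℕ)) (r : List ℕ) (θ : List ℕ → Fml P A) (q : List ℕ → P) (x : List ℕ) :
    Fml P A :=
  (π.quasiProof C r).iota (π.thetaAt C θ) q x

/-- The formula `θ_r`: the pre-interpolant at the root of the quasi-proof. -/
noncomputable def thetaRoot {P : Type u} {A : Type v} (π : SplitProof P A)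
    (C : Finset (List ℕ)) (r : List ℕ) (θ : List ℕ → Fml P A) (q : List ℕ → P) : Fml P A :=
  π.preInterpolant C r θ q []

/-- The propositions `q_x`, for `x` a node of the quasi-proof, are distinct and fresh. -/
def FreshFor {P : Type u} {A : Type v} (π : SplitProof P A) (C : Finset (List ℕ)) (r : List ℕ)
    (q : List ℕ → P) : Prop :=
  Set.InjOn q (π.quasiProof C r).nodes ∧ ∀ x ∈ (π.quasiProof C r).nodes, ∀ t ∈ π.nodes,
    Sum.inl (q x) ∉ (π.label t).l.voc ∪ (π.label t).r.voc

end SplitProof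

end CPDL

/-!
The vocabulary of each component of a split sequent can only shrink along the edges of a split
proof: premises consist of subformulas, of formulas of the negation-closed Fischer–Ladner closure
and of their negations, and a repeat carries the label of its companion
(`CPDL.SplitProof.Edge.voc_l`, `CPDL.SplitProof.Edge.voc_r`). Every node of the cluster is reachable
from its root, so the given interpolants of the exits, and hence all formulas `θ_Δ`, are in the
common vocabulary of `Γ` and `Ξ`.

A pre-interpolant is built from the `θ_Δ`, the propositions `q_y`, and the actions of the modal
rules that are applied on the right inside the cluster. What remains is that the atomic program `a`
of such an action occurs in `Γ`
(`CPDL.SplitProof.IsProperCluster.modal_mem_voc`). If it did not, then it would not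
occur in the left component at the node either, so neither of the two clauses of the modal rule
would transfer anything: the left component of the unique child would be empty. No left rule
applies to an empty component (an analytic cut needs a formula to start from), so emptiness
persists along all edges. As the cluster is strongly connected and the child is the only successor
of the node, the child leads back to the root of the cluster, which contradicts `Γ ≠ ∅`.
-/

namespace CPDL

variable {P : Type u} {A : Type v}

/-! ### Vocabularies of formulas -/

theorem Fml.voc_neg : ∀ φ : Fml P A, φ.neg.voc = φ.voc
  | .top => rfl
  | .bot => rfl
  | .pos _ => rfl
  | .npos _ => rfl
  | .and φ ψ => by simp only [Fml.neg, Fml.voc, φ.voc_neg, ψ.voc_neg]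
  | .or φ ψ => by simp only [Fml.neg, Fml.voc, φ.voc_neg, ψ.voc_neg]
  | .dia α φ => by simp only [Fml.neg, Fml.voc, φ.voc_neg]
  | .box α φ => by simp only [Fml.neg, Fml.voc, φ.voc_neg]

theorem voc_bigOr_subset {V : Set (P ⊕ A)} :
    ∀ l : List (Fml P A), (∀ φ ∈ l, φ.voc ⊆ V) → (bigOr l).voc ⊆ V
  | [], _ => by simp [bigOr, Fml.voc]
  | [φ], h => h φ (by simp)
  | φ :: ψ :: l, h => by
    simpa only [bigOr, Fml.voc] using Set.union_subset (h φ (by simp))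
      (voc_bigOr_subset (ψ :: l) fun χ hχ => h χ (List.mem_cons_of_mem _ hχ))

theorem voc_bigAnd_subset {V : Set (P ⊕ A)} :
    ∀ l : List (Fml P A), (∀ φ ∈ l, φ.voc ⊆ V) → (bigAnd l).voc ⊆ V
  | [], _ => by simp [bigAnd, Fml.voc]
  | [φ], h => h φ (by simp)
  | φ :: ψ :: l, h => by
    simpa only [bigAnd, Fml.voc] using Set.union_subset (h φ (by simp))
      (voc_bigAnd_subset (ψ :: l) fun χ hχ => h χ (List.mem_cons_of_mem _ hχ))

theorem voc_bigAlt_subset {V : Set (P ⊕ A)} :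
    ∀ l : List (Prog P A), (∀ α ∈ l, α.voc ⊆ V) → (bigAlt l).voc ⊆ V
  | [], _ => by simp [bigAlt, Fml.voc, Prog.voc]
  | [α], h => h α (by simp)
  | α :: β :: l, h => by
    simpa only [bigAlt, Prog.voc] using Set.union_subset (h α (by simp))
      (voc_bigAlt_subset (β :: l) fun χ hχ => h χ (List.mem_cons_of_mem _ hχ))

theorem FL.voc_subset {S : Set (Fml P A)} {V : Set (P ⊕ A)} (hS : ∀ φ ∈ S, φ.voc ⊆ V)
    {φ : Fml P A} (h : FL S φ) : φ.voc ⊆ V := by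
  induction h with
  | base h => exact hS _ h
  | _ =>
    simp only [Fml.voc, Prog.voc, Fml.voc_neg, Set.union_subset_iff] at *
    tauto

theorem FLneg.voc_subset {S : Set (Fml P A)} {V : Set (P ⊕ A)} (hS : ∀ φ ∈ S, φ.voc ⊆ V)
    {φ : Fml P A} (h : φ ∈ FLneg S) : φ.voc ⊆ V := by
  rcases h with h | ⟨ψ, h, rfl⟩
  · exact h.voc_subset hS
  · exact ψ.voc_neg ▸ h.voc_subset hS

theorem FL.nonempty {S : Set (Fml P A)} {φ : Fml P A} (h : FL S φ) : S.Nonempty := by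
  induction h with
  | base h => exact ⟨_, h⟩
  | _ => assumption

theorem FLneg.nonempty {S : Set (Fml P A)} {φ : Fml P A} (h : φ ∈ FLneg S) : S.Nonempty := by
  rcases h with h | ⟨ψ, h, -⟩ <;> exact h.nonempty

/-! ### Vocabularies of sequents and rules -/

namespace Sequent

theorem voc_subset_iff {Γ : Sequent P A} {V : Set (P ⊕ A)} :
    Γ.voc ⊆ V ↔ ∀ φ o, (φ, o) ∈ Γ → φ.voc ⊆ V := by
  simp [voc, forms]

theorem subset_voc {Γ : Sequent P A} {φ : Fml P A} {o : Ann} (h : (φ, o) ∈ Γ) : φ.voc ⊆ Γ.voc :=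
  voc_subset_iff.1 subset_rfl φ o h

theorem voc_insert (φ : Fml P A) (o : Ann) (Γ : Sequent P A) :
    Sequent.voc (insert (φ, o) Γ) = φ.voc ∪ Γ.voc := by
  apply subset_antisymm
  · rw [voc_subset_iff]
    rintro ψ o' (h | h)
    · obtain ⟨rfl, -⟩ := Prod.mk.inj h
      exact Set.subset_union_left
    · exact (subset_voc h).trans Set.subset_union_right
  · exact Set.union_subset (subset_voc (Set.mem_insert _ _))
      (voc_subset_iff.2 fun _ _ h => subset_voc (Set.mem_insert_of_mem _ h))

theorem voc_of_mem_FLneg {Γ : Sequent P A} {φ : Fml P A} (h : φ ∈ FLneg Γ.forms) :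
    φ.voc ⊆ Γ.voc :=
  FLneg.voc_subset (S := Γ.forms) (fun _ hψ => hψ.elim fun _ ho => subset_voc ho) h

theorem voc_jump (a : Action A) (Γ : Sequent P A) : (Γ.jump a).voc ⊆ Γ.voc := by
  rw [voc_subset_iff]
  rintro φ o (⟨χ, o', h, hχ⟩ | ⟨χ, o', h, -, hχ⟩)
  · obtain ⟨rfl, -⟩ := Prod.mk.inj h
    exact Set.subset_union_right.trans (subset_voc hχ)
  · obtain ⟨rfl, -⟩ := Prod.mk.inj h
    exact voc_of_mem_FLneg hχ

/-- Both clauses of the definition of `jump` need a formula of the closure in which the atomic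
program of `a` occurs. -/
theorem jump_eq_empty {a : Action A} {Γ : Sequent P A} (h : Sum.inr a.1 ∉ Γ.voc) :
    Γ.jump a = ∅ := by
  rw [Set.eq_empty_iff_forall_notMem]
  rintro x (⟨χ, o, -, hχ⟩ | ⟨χ, o, -, -, hχ⟩)
  · exact h (subset_voc hχ (by simp [Fml.voc, Prog.voc]))
  · exact h (voc_of_mem_FLneg hχ (by simp [Fml.voc, Prog.voc, Action.conv]))

theorem voc_empty : Sequent.voc (∅ : Sequent P A) = ∅ := by simp [voc, forms]

end Sequent

namespace Rule

theorem voc_passive (R : Rule P A) (Γ : Sequent P A) : (R.passive Γ).voc ⊆ Γ.voc := by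
  unfold passive
  split
  · exact Sequent.voc_jump _ _
  · exact subset_rfl

theorem passive_empty (R : Rule P A) : R.passive (∅ : Sequent P A) = ∅ := by
  unfold passive
  split
  · exact Sequent.jump_eq_empty (by simp [Sequent.voc_empty])
  · rfl

theorem passive_of_modal {R : Rule P A} {a : Action A} (h : R.modal = some a) (Γ : Sequent P A) :
    R.passive Γ = Γ.jump a := by
  simp [passive, h]

theorem voc_prems {R : Rule P A} (hR : R.Side) {Δ : Sequent P A} (h : Δ ∈ R.prems) :
    Δ.voc ⊆ R.concl.voc := by
  cases R with
  | diaAct a φ o Γ =>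
    obtain rfl := List.mem_singleton.1 h
    rw [Sequent.voc_insert]
    refine Set.union_subset ?_ (Sequent.voc_jump _ _)
    simp only [concl, Sequent.voc_insert, Fml.voc]
    exact Set.subset_union_right.trans Set.subset_union_left
  | cut φ Γ =>
    have hφ : φ.voc ⊆ Γ.voc := Sequent.voc_of_mem_FLneg hR
    simp only [prems, List.mem_cons, List.not_mem_nil, or_false] at h
    rcases h with rfl | rfl <;>
      simpa [Sequent.voc_insert, concl, Fml.voc_neg] using hφ
  | _ =>
    simp only [prems, List.mem_cons, List.not_mem_nil, or_false] at h
    first | subst h | rcases h with rfl | rfl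
    all_goals
      simp only [Sequent.voc_insert, concl, Fml.voc, Prog.voc, Fml.voc_neg]
      intro b
      simp only [Set.mem_union]
      tauto

/-- No rule acts on an empty component; for cut this is due to analyticity. -/
theorem concl_nonempty {R : Rule P A} (hR : R.Side) : R.concl.Nonempty := by
  cases R with
  | cut φ Γ =>
    obtain ⟨ψ, o, h⟩ := FLneg.nonempty hR
    exact ⟨_, h⟩
  | _ => exact Set.insert_nonempty _ _

theorem modal_mem_voc {R : Rule P A} {a : Action A} (h : R.modal = some a) :
    Sum.inr a.1 ∈ R.concl.voc := by
  cases R <;> simp [modal] at h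
  subst h
  exact Sequent.subset_voc (Set.mem_insert _ _) (by simp [Fml.voc, Prog.voc])

end Rule

/-! ### Edges and clusters of split proofs -/

namespace SplitProof

variable {π : SplitProof P A} {C : Finset (List ℕ)}

/-- An edge of the proof graph leads from the conclusion of a rule to a premise, or from a repeat to
its companion. -/
theorem Edge.cases {s t : List ℕ} (h : π.Edge s t) :
    (∃ R : Rule P A, R.Side ∧ (π.label s).l = R.concl ∧ (π.label t).l ∈ R.prems ∧
      (π.label t).r = R.passive (π.label s).r) ∨
    (∃ R : Rule P A, π.step s = .right R ∧ R.Side ∧ (π.label s).r = R.concl ∧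
      (π.label t).r ∈ R.prems ∧ (π.label t).l = R.passive (π.label s).l) ∨
    π.label t = π.label s := by
  obtain ⟨hs, ht, ⟨i, rfl⟩ | h⟩ := h
  · cases hstep : π.step s with
    | closed => exact absurd ht ((π.closed_ok s hs hstep).2 i)
    | rep c => exact absurd ht ((π.rep_ok s hs c hstep).1 i)
    | left R =>
      obtain ⟨h1, h2, h3, h4⟩ := π.left_ok s hs R hstep
      have hi := (h3 i).1 ht
      exact Or.inl ⟨R, h1, h2, by rw [h4 i hi]; exact List.getElem_mem hi, by rw [h4 i hi]⟩
    | right R =>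
      obtain ⟨h1, h2, h3, h4⟩ := π.right_ok s hs R hstep
      have hi := (h3 i).1 ht
      exact Or.inr (Or.inl
        ⟨R, rfl, h1, h2, by rw [h4 i hi]; exact List.getElem_mem hi, by rw [h4 i hi]⟩)
  · exact Or.inr (Or.inr (π.rep_ok s hs t h).2.2.2.1)

theorem Edge.voc_l {s t : List ℕ} (h : π.Edge s t) : (π.label t).l.voc ⊆ (π.label s).l.voc := by
  obtain ⟨R, hR, h1, h2, -⟩ | ⟨R, -, -, -, -, h1⟩ | h := h.cases
  · exact h1 ▸ Rule.voc_prems hR h2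
  · exact h1 ▸ R.voc_passive _
  · rw [h]

theorem Edge.voc_r {s t : List ℕ} (h : π.Edge s t) : (π.label t).r.voc ⊆ (π.label s).r.voc := by
  obtain ⟨R, -, -, -, h1⟩ | ⟨R, -, hR, h1, h2, -⟩ | h := h.cases
  · exact h1 ▸ R.voc_passive _
  · exact h1 ▸ Rule.voc_prems hR h2
  · rw [h]

theorem Edge.l_eq_empty {s t : List ℕ} (h : π.Edge s t) (hs : (π.label s).l = ∅) :
    (π.label t).l = ∅ := by
  obtain ⟨R, hR, h1, -⟩ | ⟨R, -, -, -, -, h1⟩ | h := h.cases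
  · exact absurd (h1 ▸ hs) (Rule.concl_nonempty hR).ne_empty
  · rw [h1, hs, R.passive_empty]
  · rw [h, hs]

theorem voc_subset_of_transGen {s t : List ℕ} (h : Relation.TransGen π.Edge s t) :
    (π.label t).l.voc ⊆ (π.label s).l.voc ∧ (π.label t).r.voc ⊆ (π.label s).r.voc := by
  induction h with
  | single h => exact ⟨h.voc_l, h.voc_r⟩
  | tail _ h ih => exact ⟨h.voc_l.trans ih.1, h.voc_r.trans ih.2⟩

theorem l_eq_empty_of_reflTransGen {s t : List ℕ} (h : Relation.ReflTransGen π.Edge s t)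
    (hs : (π.label s).l = ∅) : (π.label t).l = ∅ := by
  induction h with
  | refl => exact hs
  | tail _ h ih => exact h.l_eq_empty ih

theorem IsProperCluster.transGen (hC : π.IsProperCluster C) {s t : List ℕ} (hs : s ∈ C)
    (ht : t ∈ C) : Relation.TransGen π.Edge s t :=
  ((hC.2 s hs t).1 ht).1

theorem IsProperCluster.voc_subset_of_mem_cplus (hC : π.IsProperCluster C) {r t : List ℕ}
    (hr : r ∈ C) (ht : t ∈ π.cplus C) :
    (π.label t).l.voc ∩ (π.label t).r.voc ⊆ (π.label r).l.voc ∩ (π.label r).r.voc := by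
  have key : Relation.TransGen π.Edge r t := by
    simp only [cplus, Finset.mem_filter] at ht
    obtain ⟨htn, ht | ⟨s, hs, i, rfl⟩⟩ := ht
    · exact hC.transGen hr ht
    · obtain ⟨_, -, he⟩ := Relation.TransGen.tail'_iff.1 (hC.transGen hr hs)
      exact (hC.transGen hr hs).tail ⟨he.2.1, htn, Or.inl ⟨i, rfl⟩⟩
  exact Set.inter_subset_inter (voc_subset_of_transGen key).1 (voc_subset_of_transGen key).2

theorem IsProperCluster.voc_thetaAt (hC : π.IsProperCluster C) {r : List ℕ} (hr : r ∈ C)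
    {θ : List ℕ → Fml P A}
    (hθ : ∀ t ∈ π.cplus C, t ∉ C → IsInterpolant (θ t) (π.label t)) (Δ : Sequent P A) :
    (π.thetaAt C θ Δ).voc ⊆ (π.label r).l.voc ∩ (π.label r).r.voc := by
  apply voc_bigAnd_subset
  intro φ hφ
  obtain ⟨t, ht, rfl⟩ := List.mem_map.1 hφ
  obtain ⟨ht, htC, -⟩ := Finset.mem_filter.1 (Finset.mem_toList.1 ht)
  exact (hθ t ht htC).1.trans (hC.voc_subset_of_mem_cplus hr ht)

/-- The atomic program of a modal rule applied on the right inside a proper cluster occurs on both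
sides of every sequent of the cluster whose left component is nonempty. -/
theorem IsProperCluster.modal_mem_voc (hC : π.IsProperCluster C) {r t : List ℕ} (hr : r ∈ C)
    (hne : (π.label r).l.Nonempty) (ht : t ∈ C) {R : Rule P A} (hR : π.step t = .right R)
    {a : Action A} (ha : R.modal = some a) :
    Sum.inr a.1 ∈ (π.label r).l.voc ∩ (π.label r).r.voc := by
  have hrt := voc_subset_of_transGen (hC.transGen hr ht)
  -- `s` is the first node on a path from `t` back to `r`: the child of `t`, as `t` is no repeat.
  obtain ⟨s, hts, hsr⟩ := Relation.TransGen.head'_iff.1 (hC.transGen ht hr)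
  have htn := hts.1
  obtain ⟨-, hconcl, -, -⟩ := π.right_ok t htn R hR
  refine ⟨?_, hrt.2 (hconcl ▸ Rule.modal_mem_voc ha)⟩
  by_contra hna
  have hjump : (π.label t).l.jump a = ∅ := Sequent.jump_eq_empty fun h => hna (hrt.1 h)
  have hs : (π.label s).l = ∅ := by
    obtain ⟨-, hsn, ⟨i, rfl⟩ | hrep⟩ := hts
    · obtain ⟨-, -, h3, h4⟩ := π.right_ok t htn R hR
      rw [h4 i ((h3 i).1 hsn), R.passive_of_modal ha, hjump]
    · rw [hR] at hrep
      cases hrep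
  exact hne.ne_empty (l_eq_empty_of_reflTransGen hsr hs)

theorem exists_of_rightRule {Δ : Sequent P A} {R : Rule P A} (h : π.rightRule C Δ = some R) :
    ∃ t ∈ C, (π.label t).r = Δ ∧ π.step t = .right R := by
  unfold rightRule at h
  split at h
  · rename_i hex
    exact Option.some.inj h ▸ hex.choose_spec
  · cases h

end SplitProof

/-! ### Vocabularies of pre-interpolants -/

namespace QTree

/-- The atomic programs of all modal rules recorded in the tree belong to `V`. -/
def ModalIn (V : Set (P ⊕ A)) : QTree P A → Prop
  | leaf _ => True
  | one _ z => z.ModalIn V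
  | two _ z => z.ModalIn V
  | three _ R _ z =>
      (∀ a, R.bind Rule.modal = some a → Sum.inr a.1 ∈ V) ∧ ∀ i, (z i).ModalIn V

variable {V : Set (P ⊕ A)}

theorem ModalIn.child {T S : QTree P A} {i : ℕ} (hT : T.ModalIn V) (h : T.child i = some S) :
    S.ModalIn V := by
  cases T with
  | leaf => cases h
  | one Δ z =>
    simp only [QTree.child, Option.ite_none_right_eq_some, Option.some.injEq] at h
    exact h.2 ▸ hT
  | two Δ z =>
    simp only [QTree.child, Option.ite_none_right_eq_some, Option.some.injEq] at h
    exact h.2 ▸ hT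
  | three Δ R n z =>
    simp only [QTree.child, Option.dite_none_right_eq_some, Option.some.injEq] at h
    obtain ⟨hi, rfl⟩ := h
    exact hT.2 _

theorem ModalIn.sub {Q : QTree P A} (hQ : Q.ModalIn V) :
    ∀ {x : List ℕ} {T : QTree P A}, Q.sub x = some T → T.ModalIn V
  | [], _, h => Option.some.inj h ▸ hQ
  | _ :: _, _, h => by
    obtain ⟨S, hS, hT⟩ := Option.bind_eq_some_iff.1 h
    exact (hQ.sub hS).child hT

variable {th : Sequent P A → Fml P A}

theorem voc_alpha (hth : ∀ Δ, (th Δ).voc ⊆ V) (Q : QTree P A) {T : QTree P A} (hT : T.ModalIn V)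
    (x y : List ℕ) :
    (Q.alpha th T x y).voc ⊆ V := by
  induction T generalizing x y with
  | leaf => simp [alpha, Prog.voc, Fml.voc]
  | one Δ z ih =>
    have ih := ih hT (0 :: x)
    unfold alpha
    split
    · exact Set.union_subset (ih x) (ih y)
    · exact ih y
  | two Δ z ih => exact Set.union_subset (hth Δ) (ih hT _ _)
  | three Δ R n z ih =>
    have hβ := voc_bigAlt_subset (V := V)
      (((List.finRange n).filter fun i => y ∈ Q.K (i.val :: x)).map
        fun i => alpha Q th (z i) (i.val :: x) y) (by
          intro α hα
          obtain ⟨i, -, rfl⟩ := List.mem_map.1 hα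
          exact ih i (hT.2 i) _ _)
    simp only [alpha]
    split
    · rename_i a ha
      exact Set.union_subset (Set.singleton_subset_iff.2 (hT.1 a ha)) hβ
    · exact hβ

theorem voc_psi (hth : ∀ Δ, (th Δ).voc ⊆ V) (Q : QTree P A) {T : QTree P A} (hT : T.ModalIn V)
    (x : List ℕ) :
    (Q.psi th T x).voc ⊆ V := by
  induction T generalizing x with
  | leaf Δ =>
    unfold psi
    split
    · exact Set.empty_subset _
    · exact hth Δ
  | one Δ z ih =>
    unfold psi
    split
    · exact Set.union_subset (voc_alpha hth Q (T := z) hT _ _) (ih hT _)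
    · exact ih hT _
  | two Δ z ih => exact Set.union_subset (hth Δ) (ih hT _)
  | three Δ R n z ih =>
    have hχ := voc_bigOr_subset (V := V)
      ((List.finRange n).map fun i => psi Q th (z i) (i.val :: x)) (by
        intro φ hφ
        obtain ⟨i, -, rfl⟩ := List.mem_map.1 hφ
        exact ih i (hT.2 i) _)
    simp only [psi]
    split
    · rename_i a ha
      exact Set.union_subset (Set.singleton_subset_iff.2 (hT.1 a ha)) hχ
    · exact hχ

theorem voc_iota (hth : ∀ Δ, (th Δ).voc ⊆ V) {Q : QTree P A} (hQ : Q.ModalIn V)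
    (q : List ℕ → P) (x : List ℕ) :
    (Q.iota th q x).voc ⊆ V ∪ {b | ∃ y ∈ Q.K x, b = Sum.inl (q y)} := by
  unfold iota
  split
  · rename_i T hx
    have hT := hQ.sub hx
    refine Set.union_subset ((voc_psi hth Q hT x).trans Set.subset_union_left)
      (voc_bigOr_subset _ fun φ hφ => ?_)
    obtain ⟨y, hy, rfl⟩ := List.mem_map.1 hφ
    exact Set.union_subset_union (voc_alpha hth Q hT x y)
      (Set.singleton_subset_iff.2 ⟨y, hy, rfl⟩)
  · exact Set.empty_subset _

end QTree

theorem SplitProof.modalIn_build {π : SplitProof P A} {C : Finset (List ℕ)} {V : Set (P ⊕ A)}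
    (hV : ∀ t ∈ C, ∀ R a, π.step t = .right R → R.modal = some a → Sum.inr a.1 ∈ V)
    (anc : Set (Sequent P A)) (Δ : Sequent P A) : (π.build C anc Δ).ModalIn V := by
  induction anc, Δ using SplitProof.build.induct π C with
  | case1 anc Δ h ih =>
    rw [build, dif_pos h]
    refine ⟨fun a ha => ?_, ih⟩
    obtain ⟨R, hR, ha⟩ := Option.bind_eq_some_iff.1 ha
    obtain ⟨t, ht, -, hstep⟩ := exists_of_rightRule hR
    exact hV t ht R a hstep ha
  | case2 anc Δ h =>
    rw [build, dif_neg h]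
    trivial

end CPDL

theorem lemmal {P : Type u} {A : Type v} (π : CPDL.SplitProof P A) (C : Finset (List ℕ))
    (hC : π.IsProperCluster C) (hfoc : π.RightFocused C) (hunif : π.Uniform C)
    (r : List ℕ) (hr : π.IsClusterRoot C r) (hne : (π.label r).l.Nonempty)
    (θ : List ℕ → CPDL.Fml P A)
    (hθ : ∀ t ∈ π.cplus C, t ∉ C → CPDL.IsInterpolant (θ t) (π.label t))
    (q : List ℕ → P) (hq : π.FreshFor C r q) :
    (∀ x ∈ (π.quasiProof C r).nodes,
      (π.preInterpolant C r θ q x).voc ⊆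
        ((π.label r).l.voc ∩ (π.label r).r.voc) ∪
          {b | ∃ y ∈ (π.quasiProof C r).K x, b = Sum.inl (q y)}) ∧
    (π.thetaRoot C r θ q).voc ⊆ (π.label r).l.voc ∩ (π.label r).r.voc := by
  have hV := hC.voc_thetaAt hr.1 hθ
  have hQ : (π.quasiProof C r).ModalIn ((π.label r).l.voc ∩ (π.label r).r.voc) :=
    π.modalIn_build (fun t ht R a hR ha => hC.modal_mem_voc hr.1 hne ht hR ha) _ _
  refine ⟨fun x _ => CPDL.QTree.voc_iota hV hQ q x, ?_⟩
  -- The root has no proper ancestors, so `K` is empty there.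
  rw [CPDL.SplitProof.thetaRoot, CPDL.SplitProof.preInterpolant]
  have h := CPDL.QTree.voc_iota hV hQ q []
  simpa only [CPDL.QTree.K, List.tails, List.tail_cons, List.filter_nil, List.not_mem_nil,
    false_and, exists_false, Set.ofPred_false, Set.union_empty] using h
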